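/- Proposition 1.1. Let $D$ be a finite (nonempty) distributive lattice with least element $0$ and greatest element $1$. Let $J_0(D)$ be the set consisting of $0$ and of all join-irreducible elements of $D$. For a nonempty (possibly infinite) algebra $A$ with finitary operations, $\mathrm{Con}(A)$ is the congruence lattice of $A$ and $\mathrm{Princ}(A)\subseteq\mathrm{Con}(A)$ is the set of principal congruences $\mathrm{con}(a,b)$, $a,b\in A$, where $\mathrm{con}(a,b)$ is the least congruence containing $(a,b)$. For $Q\subseteq D$, the inclusion $Q\subseteq D$ is represented by the principal congruences of $A$ if there is a lattice isomorphism $\varphi\colon \mathrm{Con}(A)\to D$ with $\varphi(\mathrm{Princ}(A))=Q$. A lattice is planar if it is finite and has a planar Hasse diagram, that is, a diagram in the plane in which larger elements are placed higher, covering pairs are joined by straight line segments, and these edges meet only at common endpoints. Then the following two conditions are equivalent. (a) For every set $Q$ with $J_0(D)\subseteq Q\subseteq D$, the inclusion $Q\subseteq D$ is represented by the principal congruences of some algebra $A$. (b) The lattice $D$ is planar and $1\in J_0(D)$. Moreover, $1\in J_0(D)$ holds if and only if $|D|=1$ or $D$ has exactly one coatom. -/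

import Mathlib

universe u v w

namespace PrincRep

/-! ### Finite lattices: join-irreducible elements and planarity -/

/-- `J(D)`: the set of nonzero join-irreducible elements. In Mathlib, `SupIrred x` already
excludes the least element. -/
def J (D : Type u) [Lattice D] : Set D := {x | SupIrred x}

/-- `J₀(D) = J(D) ∪ {0}`. -/
def J₀ (D : Type u) [Lattice D] [BoundedOrder D] : Set D := J D ∪ {⊥}

/-- A placement of the elements of an ordered set in the plane is a *planar (Hasse) diagram* if
distinct elements are placed at distinct points, larger elements are placed higher, the straight
line segments (edges) that join `a` and `b` for the covering pairs `a ⋖ b` pass through no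
further elements, and two distinct edges can meet only at a common endpoint. -/
structure IsPlanarDiagram {P : Type u} [PartialOrder P] (pos : P → ℝ × ℝ) : Prop where
  injective : Function.Injective pos
  upward : ∀ a b : P, a < b → (pos a).2 < (pos b).2
  edge_vertex : ∀ a b c : P, a ⋖ b → pos c ∈ segment ℝ (pos a) (pos b) → c = a ∨ c = b
  edge_edge : ∀ a b c d : P, a ⋖ b → c ⋖ d → (a, b) ≠ (c, d) →
    segment ℝ (pos a) (pos b) ∩ segment ℝ (pos c) (pos d) ⊆
      ({pos a, pos b} : Set (ℝ × ℝ)) ∩ {pos c, pos d}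

/-- A lattice is *planar* if it is finite and has a planar Hasse diagram. -/
def IsPlanar (D : Type u) [Lattice D] : Prop :=
  Finite D ∧ ∃ pos : D → ℝ × ℝ, IsPlanarDiagram pos

/-! ### Congruences of an algebra

A similarity type of algebras is a first-order language `L` without relation symbols, and an algebra
of that type is an `L`-structure: it interprets every function symbol of arity `n` as an
`n`-ary operation. -/

/-- An equivalence relation on `A` is a congruence if all operations preserve it. -/
def IsCongruence (L : FirstOrder.Language.{v, 0}) {A : Type w} [L.Structure A] (r : Setoid A) : Prop :=
  ∀ (n : ℕ) (f : L.Functions n) (x y : Fin n → A),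
    (∀ i, r (x i) (y i)) →
      r (FirstOrder.Language.Structure.funMap f x) (FirstOrder.Language.Structure.funMap f y)

/-- `Con(A)`: the congruences of `A`, ordered by inclusion (as equivalence relations). -/
def Congruence (L : FirstOrder.Language.{v, 0}) (A : Type w) [L.Structure A] : Type w :=
  {r : Setoid A // IsCongruence L r}

section

variable (L : FirstOrder.Language.{v, 0}) (A : Type w) [L.Structure A]

instance : PartialOrder (Congruence L A) :=
  inferInstanceAs (PartialOrder {r : Setoid A // IsCongruence L r})

/-- The infimum of a set of congruences is its intersection. -/
instance : InfSet (Congruence L A) where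
  sInf S := ⟨sInf (Subtype.val '' S), by
    intro n f x y h
    rintro r ⟨θ, hθ, rfl⟩
    exact θ.2 n f x y fun i => h i θ.1 ⟨θ, hθ, rfl⟩⟩

/-- The congruence lattice of `A`; its order is inclusion. -/
instance : CompleteLattice (Congruence L A) :=
  completeLatticeOfInf (Congruence L A) (by
    intro S
    constructor
    · intro θ hθ
      exact sInf_le (α := Setoid A) ⟨θ, hθ, rfl⟩
    · intro ψ hψ
      refine le_sInf (α := Setoid A) ?_
      rintro r ⟨θ, hθ, rfl⟩
      exact hψ hθ)

variable {A}

/-- `con(a, b)`: the least congruence that contains the pair `(a, b)`. -/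
def con (a b : A) : Congruence L A :=
  sInf {θ | θ.1 a b}

theorem con_isLeast (a b : A) : IsLeast {θ : Congruence L A | θ.1 a b} (con L a b) := by
  refine ⟨?_, fun θ hθ => sInf_le hθ⟩
  rintro r ⟨θ, hθ, rfl⟩
  exact hθ

variable (A)

/-- `Princ(A)`: the set of principal congruences of `A`. -/
def Princ : Set (Congruence L A) := {θ | ∃ a b : A, θ = con L a b}

end

/-- The inclusion `Q ⊆ D` is represented by the principal congruences of the algebra `A`: there is
an isomorphism `Con(A) → D` that maps `Princ(A)` onto `Q`. (An order isomorphism between lattices is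
the same as a lattice isomorphism.) -/
def RepresentsInclusion (L : FirstOrder.Language.{v, 0}) (A : Type w) [L.Structure A]
    {D : Type u} [Lattice D] (Q : Set D) : Prop :=
  ∃ φ : Congruence L A ≃o D, φ '' Princ L A = Q

/-- Every inclusion `Q ⊆ D` with `J₀(D) ⊆ Q` is represented by the principal congruences of some
(nonempty, possibly infinite) algebra. The universe levels are those of `D`, of the set of operation
symbols and of the underlying set of the algebra. -/
def FullyRepresentable (D : Type u) [Lattice D] [BoundedOrder D] : Prop :=
  ∀ Q : Set D, J₀ D ⊆ Q →
    ∃ (L : FirstOrder.Language.{v, 0}) (_ : L.IsAlgebraic) (A : Type w) (_ : Nonempty A)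
      (_ : L.Structure A), RepresentsInclusion L A Q

end PrincRep

/-! Both conditions reduce to `WidthLETwo (J D)`, the absence of three pairwise incomparable
join-irreducible elements, together with `⊤ ∈ J₀ D`. Join-irreducible elements of a distributive
lattice are join-prime, which is used throughout.

Planarity is equivalent to width at most two. A three-element antichain in `J D` yields a cube of
covers, and an intermediate value argument shows that a cube has no planar diagram
(`IsPlanarDiagram.widthLETwo_J`). Conversely, Dilworth's theorem splits `J D` into two chains;
counting the elements of each chain below `x` places `D` in a square grid with unit edges
(`SplitsIntoChains.isPlanarDiagram`).

Necessity in (a) comes from two choices of `Q`. For `Q = J₀ D`, a reducible `⊤` would make the full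
relation a union of two proper equivalences. For `Q = J₀ D ∪ {p ⊔ q ⊔ r}` with an antichain `p, q,
r`, the union of the three corresponding congruences would be a congruence and hence their join, but
it misses a generating pair of that join.

For sufficiency, take a finite `D`-valued ultrametric space whose set of distances is `Q`, with all
contractions as operations. Its congruences are exactly the relations `d a b ≤ z`, and `con(a, b)`
corresponds to `d a b`. Width two makes every nonzero element a join of two irreducibles, so it is
realized by a three-point space; such spaces are glued at distance `⊤`. -/

namespace PrincRep

/-! ### Covering a finite ordered set of width at most two by two chains -/

section TwoChains

variable {α : Type u} [PartialOrder α]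

/-- Among any three elements of `s` there are two comparable ones. -/
def WidthLETwo (s : Set α) : Prop :=
  ∀ p ∈ s, ∀ q ∈ s, ∀ r ∈ s, (p ≤ q ∨ q ≤ p) ∨ (p ≤ r ∨ r ≤ p) ∨ (q ≤ r ∨ r ≤ q)

/-- `C` splits `s` into two chains, `s ∩ C` and `s \ C`. -/
def SplitsIntoChains (s C : Set α) : Prop :=
  ∀ x ∈ s, ∀ y ∈ s, (x ∈ C ↔ y ∈ C) → x ≤ y ∨ y ≤ x

theorem SplitsIntoChains.compl {s C : Set α} (h : SplitsIntoChains s C) :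
    SplitsIntoChains s Cᶜ := fun x hx y hy hxy =>
  h x hx y hy (not_iff_not.mp hxy)

/-- The new chain is `a` on top of the part of `C` up to `x`. The part of `C` above `x` moves to the
other chain, which `hmax` permits. -/
theorem SplitsIntoChains.insert {s C : Set α} (h : SplitsIntoChains s C) {a x : α}
    (hxs : x ∈ s) (hxC : x ∈ C) (hxa : x ≤ a)
    (hmax : ∀ z ∈ s, z ∈ C → x < z → ∀ y ∈ s, y ∉ C → z ≤ y ∨ y ≤ z) :
    ∃ C', SplitsIntoChains (insert a s) C' := by
  refine ⟨{z | z = a ∨ (z ∈ C ∧ z ≤ x)}, ?_⟩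
  have habove : ∀ z ∈ s, z ∈ C → ¬ z ≤ x → x < z := fun z hz hzC hzx =>
    lt_of_le_not_ge ((h z hz x hxs (by simp [hzC, hxC])).resolve_left hzx) hzx
  intro y hy z hz hyz
  simp only [Set.mem_ofPred_eq] at hyz
  by_cases hya : y = a
  · subst hya
    rcases hyz.1 (Or.inl rfl) with rfl | ⟨-, hzx⟩
    · exact Or.inl le_rfl
    · exact Or.inr (hzx.trans hxa)
  by_cases hza : z = a
  · subst hza
    rcases hyz.2 (Or.inl rfl) with rfl | ⟨-, hyx⟩
    · exact Or.inl le_rfl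
    · exact Or.inl (hyx.trans hxa)
  replace hy := hy.resolve_left hya
  replace hz := hz.resolve_left hza
  simp only [hya, hza, false_or] at hyz
  by_cases hyC : y ∈ C <;> by_cases hzC : z ∈ C
  · exact h y hy z hz (by simp [hyC, hzC])
  · exact hmax y hy hyC (habove y hy hyC fun hle => hzC (hyz.1 ⟨hyC, hle⟩).1) z hz hzC
  · exact (hmax z hz hzC (habove z hz hzC fun hle => hyC (hyz.2 ⟨hzC, hle⟩).1) y hy hyC).symm
  · exact h y hy z hz (by simp [hyC, hzC])

theorem SplitsIntoChains.exists_top_incomparable {s C : Set α} (hfin : s.Finite)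
    (h : SplitsIntoChains s C)
    (hne : ∃ x ∈ s, x ∈ C ∧ ∃ y ∈ s, y ∉ C ∧ ¬ (x ≤ y ∨ y ≤ x)) :
    ∃ x ∈ s, x ∈ C ∧ (∃ y ∈ s, y ∉ C ∧ ¬ (x ≤ y ∨ y ≤ x)) ∧
      ∀ z ∈ s, z ∈ C → (∃ y ∈ s, y ∉ C ∧ ¬ (z ≤ y ∨ y ≤ z)) → z ≤ x := by
  obtain ⟨x₀, h₀s, h₀C, h₀⟩ := hne
  have hT : {x ∈ s | x ∈ C ∧ ∃ y ∈ s, y ∉ C ∧ ¬ (x ≤ y ∨ y ≤ x)}.Finite :=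
    hfin.subset (Set.sep_subset _ _)
  obtain ⟨x, hx⟩ := hT.exists_maximal ⟨x₀, h₀s, h₀C, h₀⟩
  obtain ⟨hxs, hxC, hxy⟩ := hx.prop
  refine ⟨x, hxs, hxC, hxy, fun z hz hzC hzy => ?_⟩
  rcases h z hz x hxs (by simp [hzC, hxC]) with hle | hle
  · exact hle
  · exact hx.le_of_ge ⟨hz, hzC, hzy⟩ hle

/-- Dilworth's theorem for width two. -/
theorem WidthLETwo.exists_splitsIntoChains {s : Set α} (hfin : s.Finite) (h : WidthLETwo s) :
    ∃ C, SplitsIntoChains s C := by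
  induction hn : s.ncard using Nat.strong_induction_on generalizing s with
  | _ n ih =>
    rcases s.eq_empty_or_nonempty with rfl | hne
    · exact ⟨∅, fun x hx => absurd hx (Set.notMem_empty x)⟩
    obtain ⟨a, ha⟩ := hfin.exists_maximal hne
    have hfin' : (s \ {a}).Finite := hfin.subset Set.sdiff_subset
    obtain ⟨C, hC⟩ := ih (s \ {a}).ncard
      (hn ▸ Set.ncard_sdiff_singleton_lt_of_mem ha.prop hfin) hfin'
      (fun p hp q hq r hr => h p hp.1 q hq.1 r hr.1) rfl
    have hins : insert a (s \ {a}) = s := by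
      rw [Set.insert_sdiff_singleton, Set.insert_eq_of_mem ha.prop]
    by_cases hinc : ∃ x ∈ s \ {a}, x ∈ C ∧ ∃ y ∈ s \ {a}, y ∉ C ∧ ¬ (x ≤ y ∨ y ≤ x)
    · obtain ⟨x, hxs, hxC, ⟨y', hy's, hy'C, hxy'⟩, hxmax⟩ := hC.exists_top_incomparable hfin' hinc
      obtain ⟨y, hys, hyC, ⟨x', hx's, hx'C, hyx'⟩, hymax⟩ :=
        hC.compl.exists_top_incomparable hfin'
          ⟨y', hy's, hy'C, x, hxs, not_not.mpr hxC, fun h => hxy' h.symm⟩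
      rw [Set.mem_compl_iff, not_not] at hx'C
      have hy'y : y' ≤ y := hymax y' hy's hy'C
        ⟨x, hxs, not_not.mpr hxC, fun h => hxy' h.symm⟩
      have hx'x : x' ≤ x := hxmax x' hx's hx'C ⟨y, hys, hyC, fun h => hyx' h.symm⟩
      have hnot : ∀ z ∈ s \ {a}, ¬ a ≤ z := fun z hz haz =>
        hz.2 (le_antisymm (ha.le_of_ge hz.1 haz) haz)
      -- The topmost elements `x`, `y` with an incomparable partner are themselves incomparable,
      -- since `x ≤ y` would give `x' ≤ y`. Width two then puts the maximal element `a` above one of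
      -- them.
      rcases h x hxs.1 y hys.1 a ha.prop with (hxy | hyx) | (hxa | hax) | (hya | hay)
      · exact absurd (Or.inr (hx'x.trans hxy)) hyx'
      · exact absurd (Or.inr (hy'y.trans hyx)) hxy'
      · rw [← hins]
        refine hC.insert hxs hxC hxa fun z hz hzC hxz y hy hyC => ?_
        by_contra hzy
        exact hxz.not_ge (hxmax z hz hzC ⟨y, hy, hyC, hzy⟩)
      · exact absurd hax (hnot x hxs)
      · rw [← hins]
        refine hC.compl.insert hys hyC hya fun z hz hzC hyz x hx hxC => ?_
        by_contra hzx
        exact hyz.not_ge (hymax z hz hzC ⟨x, hx, hxC, hzx⟩)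
      · exact absurd hay (hnot y hys)
    -- Without incomparable pairs across the two chains, everything except `a` is one chain.
    · push Not at hinc
      refine ⟨{a}, fun x hx y hy hxy => ?_⟩
      by_cases hxa : x = a
      · exact Or.inl (hxa.trans (hxy.1 hxa).symm).le
      have hya : y ≠ a := fun hya => hxa (hxy.2 hya)
      by_cases hxC : x ∈ C <;> by_cases hyC : y ∈ C
      · exact hC x ⟨hx, hxa⟩ y ⟨hy, hya⟩ (by simp [hxC, hyC])
      · exact hinc x ⟨hx, hxa⟩ hxC y ⟨hy, hya⟩ hyC
      · exact (hinc y ⟨hy, hya⟩ hyC x ⟨hx, hxa⟩ hxC).symm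
      · exact hC x ⟨hx, hxa⟩ y ⟨hy, hya⟩ (by simp [hxC, hyC])

end TwoChains

/-! ### Join-irreducible elements of finite distributive lattices -/

section Irreducible

/-- Here `p ⊓ x = p'` is covered by `p`, and modularity transports this cover to `x ⋖ x ⊔ p`. -/
theorem covBy_sup_of_isGreatest_lt {D : Type u} [DistribLattice D] {p p' x : D} (hp' : IsGreatest {y | y < p} p')
    (hx : p' ≤ x) (hpx : ¬ p ≤ x) : x ⋖ x ⊔ p := by
  have hinf : p ⊓ x = p' := le_antisymm
    (hp'.2 (lt_of_le_of_ne inf_le_left fun h => hpx (inf_eq_left.mp h)))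
    (le_inf hp'.1.le hx)
  have hcov : p ⊓ x ⋖ p := by
    rw [hinf]
    exact ⟨hp'.1, fun c hc hcp => (hp'.2 hcp).not_gt hc⟩
  simpa [sup_comm] using covBy_sup_of_inf_covBy_left hcov

variable {D : Type u} [DistribLattice D] [BoundedOrder D] [Finite D]

theorem exists_supIrred_le_not_le {x y : D} (h : ¬ y ≤ x) :
    ∃ p, SupIrred p ∧ p ≤ y ∧ ¬ p ≤ x := by
  classical
  cases nonempty_fintype D
  obtain ⟨s, rfl, hs⟩ := exists_supIrred_decomposition y
  by_contra! hcon
  exact h (Finset.sup_le fun p hp => hcon p (hs hp) (Finset.le_sup (f := id) hp))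

theorem le_of_forall_supIrred_le {x y : D} (h : ∀ p, SupIrred p → p ≤ y → p ≤ x) : y ≤ x := by
  by_contra hxy
  obtain ⟨p, hp, hpy, hpx⟩ := exists_supIrred_le_not_le hxy
  exact hpx (h p hp hpy)

/-- The greatest element strictly below a join-irreducible element. -/
theorem exists_isGreatest_lt_of_supIrred {p : D} (hp : SupIrred p) :
    ∃ p', IsGreatest {x | x < p} p' := by
  classical
  cases nonempty_fintype D
  let s : Finset D := Finset.univ.filter (· < p)
  refine ⟨s.sup id, ?_, fun x hx => Finset.le_sup (f := id) (by simpa [s] using hx)⟩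
  refine lt_of_le_of_ne (Finset.sup_le fun x hx => (by simpa [s] using hx : x < p).le) fun h => ?_
  obtain ⟨x, hx, hxp⟩ := hp.finset_sup_eq h
  exact ((by simpa [s] using hx : x < p)).ne hxp

end Irreducible

/-! ### Planar distributive lattices have join-irreducible elements of width at most two -/

section Paths

/-- The first coordinate of the point at height `t` on the line through `P` and `Q`. -/
noncomputable def lineAt (P Q : ℝ × ℝ) (t : ℝ) : ℝ :=
  P.1 + (t - P.2) / (Q.2 - P.2) * (Q.1 - P.1)

theorem lineAt_left (P Q : ℝ × ℝ) : lineAt P Q P.2 = P.1 := by simp [lineAt]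

theorem lineAt_right {P Q : ℝ × ℝ} (h : P.2 < Q.2) : lineAt P Q Q.2 = Q.1 := by
  simp [lineAt, div_self (sub_pos.mpr h).ne']

theorem continuous_lineAt (P Q : ℝ × ℝ) : Continuous (lineAt P Q) := by
  unfold lineAt
  fun_prop

theorem lineAt_mem_segment {P Q : ℝ × ℝ} (h : P.2 < Q.2) {t : ℝ} (h₁ : P.2 ≤ t) (h₂ : t ≤ Q.2) :
    (lineAt P Q t, t) ∈ segment ℝ P Q := by
  have hpos := sub_pos.mpr h
  rw [segment_eq_image']
  refine ⟨(t - P.2) / (Q.2 - P.2), ⟨by apply div_nonneg <;> linarith,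
    (div_le_one hpos).mpr (by linarith)⟩, ?_⟩
  ext
  · simp [lineAt]
  · simp [div_mul_cancel₀ _ hpos.ne']

/-- The function that follows `f` up to `s` and `g` afterwards. -/
noncomputable def joinAt (s : ℝ) (f g : ℝ → ℝ) (t : ℝ) : ℝ := if t ≤ s then f t else g t

theorem joinAt_of_le {s t : ℝ} {f g : ℝ → ℝ} (h : t ≤ s) : joinAt s f g t = f t := if_pos h

theorem joinAt_of_ge {s t : ℝ} {f g : ℝ → ℝ} (hfg : f s = g s) (h : s ≤ t) :
    joinAt s f g t = g t := by
  rcases h.eq_or_lt with rfl | h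
  · rw [joinAt_of_le le_rfl, hfg]
  · exact if_neg h.not_ge

theorem continuous_joinAt {s : ℝ} {f g : ℝ → ℝ} (hf : Continuous f) (hg : Continuous g)
    (hfg : f s = g s) : Continuous (joinAt s f g) :=
  hf.if_le hg continuous_id continuous_const fun _ hx => hx ▸ hfg

theorem lt_of_lt_of_forall_ne {f g : ℝ → ℝ} (hf : Continuous f) (hg : Continuous g) {m h : ℝ}
    (hmh : m ≤ h) (hm : f m < g m) (hne : ∀ t, m ≤ t → f t ≠ g t) : f h < g h := by
  by_contra! hcon
  obtain ⟨t, ht, ht0⟩ := intermediate_value_Icc' hmh (hg.sub hf).continuousOn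
    (show (0 : ℝ) ∈ Set.Icc _ _ from ⟨by simpa using hcon, by simpa using hm.le⟩)
  exact hne t ht.1 (sub_eq_zero.mp ht0).symm

end Paths

/-! ### Separation of paths in a planar diagram -/

section Diagram

variable {P : Type u} [PartialOrder P] {pos : P → ℝ × ℝ}

theorem IsPlanarDiagram.exists_common_vertex (hpos : IsPlanarDiagram pos) {a b c d : P}
    (hab : a ⋖ b) (hcd : c ⋖ d) (hne : (a, b) ≠ (c, d)) {x : ℝ × ℝ}
    (h₁ : x ∈ segment ℝ (pos a) (pos b)) (h₂ : x ∈ segment ℝ (pos c) (pos d)) :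
    ∃ v, (v = a ∨ v = b) ∧ (v = c ∨ v = d) ∧ x = pos v := by
  obtain ⟨h₃, h₄⟩ := hpos.edge_edge a b c d hab hcd hne ⟨h₁, h₂⟩
  rcases h₃ with rfl | rfl
  · refine ⟨a, Or.inl rfl, ?_, rfl⟩
    rcases h₄ with h | h
    exacts [Or.inl (hpos.injective h), Or.inr (hpos.injective h)]
  · refine ⟨b, Or.inr rfl, ?_, rfl⟩
    rcases h₄ with h | h
    exacts [Or.inl (hpos.injective h), Or.inr (hpos.injective h)]

/-- If an edge `u ⋖ b` starts between the edges `u ⋖ a` and `u ⋖ c`, then no path of covers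
that continues from `b` can leave the region enclosed by `u ⋖ a ⋖ d` and `u ⋖ c ⋖ d`. -/
theorem IsPlanarDiagram.false_of_between (hpos : IsPlanarDiagram pos) {u a b c d e t : P}
    (hua : u ⋖ a) (hub : u ⋖ b) (huc : u ⋖ c) (had : a ⋖ d) (hcd : c ⋖ d) (hbe : b ⋖ e)
    (het : e ⋖ t) (hdt : d < t) (hbd : ¬ b ≤ d) {m : ℝ} (hm : (pos u).2 < m)
    (hma : m ≤ (pos a).2) (hmb : m ≤ (pos b).2) (hmc : m ≤ (pos c).2)
    (hab : lineAt (pos u) (pos a) m < lineAt (pos u) (pos b) m)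
    (hbc : lineAt (pos u) (pos b) m < lineAt (pos u) (pos c) m) : False := by
  have up : ∀ {x y : P}, x ⋖ y → (pos x).2 < (pos y).2 := fun h => hpos.upward _ _ h.lt
  have hmd : m ≤ (pos d).2 := hma.trans (up had).le
  have join : ∀ {x y z : P}, x ⋖ y →
      lineAt (pos x) (pos y) (pos y).2 = lineAt (pos y) (pos z) (pos y).2 := fun h => by
    rw [lineAt_right (up h), lineAt_left]
  -- Paths as functions of the height: `side x` runs along `u`, `x`, `d`, and `mid` along `u`, `b`,
  -- `e`, `t`.
  let side : P → ℝ → ℝ := fun x =>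
    joinAt (pos x).2 (lineAt (pos u) (pos x)) (lineAt (pos x) (pos d))
  let mid₁ : ℝ → ℝ := joinAt (pos e).2 (lineAt (pos b) (pos e)) (lineAt (pos e) (pos t))
  let mid : ℝ → ℝ := joinAt (pos b).2 (lineAt (pos u) (pos b)) mid₁
  have hmid₁ : lineAt (pos u) (pos b) (pos b).2 = mid₁ (pos b).2 := by
    rw [show mid₁ (pos b).2 = _ from joinAt_of_le (up hbe).le, join hub]
  have side_cont : ∀ {x}, u ⋖ x → Continuous (side x) := fun h =>
    continuous_joinAt (continuous_lineAt _ _) (continuous_lineAt _ _) (join h)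
  have mid_cont : Continuous mid := continuous_joinAt (continuous_lineAt _ _)
    (continuous_joinAt (continuous_lineAt _ _) (continuous_lineAt _ _) (join hbe)) hmid₁
  have side_edge : ∀ {x}, u ⋖ x → x ⋖ d → ∀ s, m ≤ s → s ≤ (pos d).2 →
      ∃ z w, z ⋖ w ∧ w ≤ d ∧ (side x s, s) ∈ segment ℝ (pos z) (pos w) := by
    intro x hux hxd s hs hsd
    rcases le_total s (pos x).2 with hsx | hsx
    · refine ⟨u, x, hux, hxd.le, ?_⟩
      rw [show side x s = _ from joinAt_of_le hsx]
      exact lineAt_mem_segment (up hux) (hm.le.trans hs) hsx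
    · refine ⟨x, d, hxd, le_rfl, ?_⟩
      rw [show side x s = _ from joinAt_of_ge (join hux) hsx]
      exact lineAt_mem_segment (up hxd) hsx hsd
  have mid_edge : ∀ s, m ≤ s → s ≤ (pos d).2 →
      ∃ z w, z ⋖ w ∧ (z = u ∨ b ≤ z) ∧ b ≤ w ∧ (mid s, s) ∈ segment ℝ (pos z) (pos w) := by
    intro s hs hsd
    rcases le_total s (pos b).2 with hsb | hsb
    · refine ⟨u, b, hub, Or.inl rfl, le_rfl, ?_⟩
      rw [show mid s = _ from joinAt_of_le hsb]
      exact lineAt_mem_segment (up hub) (hm.le.trans hs) hsb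
    rw [show mid s = _ from joinAt_of_ge hmid₁ hsb]
    rcases le_total s (pos e).2 with hse | hse
    · refine ⟨b, e, hbe, Or.inr le_rfl, hbe.le, ?_⟩
      rw [show mid₁ s = _ from joinAt_of_le hse]
      exact lineAt_mem_segment (up hbe) hsb hse
    · refine ⟨e, t, het, Or.inr hbe.le, hbe.le.trans het.le, ?_⟩
      rw [show mid₁ s = _ from joinAt_of_ge (join hbe) hse]
      exact lineAt_mem_segment (up het) hse (hsd.trans (hpos.upward _ _ hdt).le)
  -- Edges of `mid` end above `b`, hence not below `d`, so they differ from the edges of `side x`. A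
  -- meeting point is thus a common vertex below `d`, which can only be `u`; but `u` lies below
  -- height `m`.
  have apart : ∀ {x}, u ⋖ x → x ⋖ d → ∀ s, m ≤ s → s ≤ (pos d).2 → side x s ≠ mid s := by
    intro x hux hxd s hs hsd heq
    obtain ⟨z, w, hzw, hwd, h₁⟩ := side_edge hux hxd s hs hsd
    obtain ⟨z', w', hzw', hz', hw', h₂⟩ := mid_edge s hs hsd
    rw [heq] at h₁
    obtain ⟨v, hv, hv', hvs⟩ := hpos.exists_common_vertex hzw hzw'
      (fun h => hbd (hw'.trans ((Prod.mk.inj h).2 ▸ hwd))) h₁ h₂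
    have hvd : v ≤ d := by
      rcases hv with rfl | rfl
      exacts [hzw.le.trans hwd, hwd]
    have hvu : v = u := by
      rcases hv' with rfl | rfl
      · exact hz'.resolve_right fun h => hbd (h.trans hvd)
      · exact absurd (hw'.trans hvd) hbd
    rw [hvu] at hvs
    exact (hm.trans_le hs).ne (congrArg Prod.snd hvs).symm
  -- clamping the height at `pos d` makes the separation hold everywhere
  have clamp : ∀ {f g : ℝ → ℝ}, Continuous f → Continuous g → f m < g m →
      (∀ s, m ≤ s → s ≤ (pos d).2 → f s ≠ g s) → f (pos d).2 < g (pos d).2 := by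
    intro f g hf hg hfg hne
    have := lt_of_lt_of_forall_ne (f := fun s => f (min s (pos d).2))
      (g := fun s => g (min s (pos d).2)) (by fun_prop) (by fun_prop) hmd
      (by simpa [min_eq_left hmd] using hfg)
      (fun s hs => hne _ (le_min hs hmd) (min_le_right _ _))
    simpa using this
  have h₁ := clamp (side_cont hua) mid_cont
    (by rw [show side a m = _ from joinAt_of_le hma, show mid m = _ from joinAt_of_le hmb]
        exact hab) (apart hua had)
  have h₂ := clamp mid_cont (side_cont huc)
    (by rw [show side c m = _ from joinAt_of_le hmc, show mid m = _ from joinAt_of_le hmb]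
        exact hbc) (fun s hs hsd => (apart huc hcd s hs hsd).symm)
  -- Both sides arrive at `d`, so `mid` would pass strictly to the right and strictly to the left of
  -- `d`.
  have hend : ∀ {x}, u ⋖ x → x ⋖ d → side x (pos d).2 = (pos d).1 := fun hux hxd => by
    rw [show side _ (pos d).2 = _ from joinAt_of_ge (join hux) (up hxd).le, lineAt_right (up hxd)]
  rw [hend hua had] at h₁
  rw [hend huc hcd] at h₂
  exact lt_asymm h₁ h₂

theorem IsPlanarDiagram.lineAt_ne (hpos : IsPlanarDiagram pos) {u a b : P} (hua : u ⋖ a)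
    (hub : u ⋖ b) (hab : a ≠ b) {m : ℝ} (hm : (pos u).2 < m) (hma : m ≤ (pos a).2)
    (hmb : m ≤ (pos b).2) : lineAt (pos u) (pos a) m ≠ lineAt (pos u) (pos b) m := by
  intro heq
  have h₁ := lineAt_mem_segment (hpos.upward _ _ hua.lt) hm.le hma
  have h₂ := lineAt_mem_segment (hpos.upward _ _ hub.lt) hm.le hmb
  rw [heq] at h₁
  obtain ⟨v, hv, hv', hvm⟩ := hpos.exists_common_vertex hua hub (by simpa using hab) h₁ h₂
  have hvu : v = u := by
    rcases hv with h | rfl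
    · exact h
    · exact hv'.resolve_right hab
  rw [hvu] at hvm
  exact hm.ne (congrArg Prod.snd hvm).symm

end Diagram

/-! ### Cubes of covers -/

section Cube

variable {D : Type u} [DistribLattice D] [BoundedOrder D] [Finite D]

/-- The joins of `u` with subsets of `{p, q, r}` form a cube. The path from `u` through `u ⊔ q` and
`u ⊔ q ⊔ p` to the top starts inside the face spanned by `p` and `r`, and must leave it. -/
theorem IsPlanarDiagram.false_of_cube {D : Type u} [DistribLattice D] {pos : D → ℝ × ℝ}
    (hpos : IsPlanarDiagram pos) {u p q r : D} (hp : SupPrime p) (hq : SupPrime q)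
    (hr : SupPrime r) (hpq : ¬ p ≤ q) (hpr : ¬ p ≤ r) (hqp : ¬ q ≤ p) (hqr : ¬ q ≤ r)
    (hrp : ¬ r ≤ p) (hrq : ¬ r ≤ q) (hpu : ¬ p ≤ u) (hqu : ¬ q ≤ u) (hru : ¬ r ≤ u)
    (cp : ∀ x, u ≤ x → ¬ p ≤ x → x ⋖ x ⊔ p) (cq : ∀ x, u ≤ x → ¬ q ≤ x → x ⋖ x ⊔ q)
    (cr : ∀ x, u ≤ x → ¬ r ≤ x → x ⋖ x ⊔ r) {m : ℝ} (hm : (pos u).2 < m)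
    (hmp : m ≤ (pos (u ⊔ p)).2) (hmq : m ≤ (pos (u ⊔ q)).2) (hmr : m ≤ (pos (u ⊔ r)).2)
    (h₁ : lineAt (pos u) (pos (u ⊔ p)) m < lineAt (pos u) (pos (u ⊔ q)) m)
    (h₂ : lineAt (pos u) (pos (u ⊔ q)) m < lineAt (pos u) (pos (u ⊔ r)) m) : False := by
  have hqd : ¬ q ≤ u ⊔ p ⊔ r := by simp [hq.le_sup, hqu, hqp, hqr]
  refine hpos.false_of_between (d := u ⊔ p ⊔ r) (e := u ⊔ q ⊔ p) (t := u ⊔ q ⊔ p ⊔ r)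
    (cp u le_rfl hpu) (cq u le_rfl hqu) (cr u le_rfl hru)
    (cr _ le_sup_left (by simp [hr.le_sup, hru, hrp])) ?_
    (cp _ le_sup_left (by simp [hp.le_sup, hpu, hpq]))
    (cr _ (le_sup_left.trans le_sup_left) (by simp [hr.le_sup, hru, hrp, hrq])) ?_
    (fun h => hqd (le_sup_right.trans h)) hm hmp hmq hmr h₁ h₂
  · rw [sup_right_comm]
    exact cp _ le_sup_left (by simp [hp.le_sup, hpu, hpr])
  · have := cq (u ⊔ p ⊔ r) (le_sup_left.trans le_sup_left) hqd
    rw [show u ⊔ q ⊔ p ⊔ r = u ⊔ p ⊔ r ⊔ q by ac_rfl]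
    exact this.lt

theorem IsPlanarDiagram.widthLETwo_J {pos : D → ℝ × ℝ} (hpos : IsPlanarDiagram pos) :
    WidthLETwo (J D) := by
  intro p hp q hq r hr
  by_contra hcon
  push Not at hcon
  obtain ⟨⟨hpq, hqp⟩, ⟨hpr, hrp⟩, hqr, hrq⟩ := hcon
  obtain ⟨p', hp'⟩ := exists_isGreatest_lt_of_supIrred hp
  obtain ⟨q', hq'⟩ := exists_isGreatest_lt_of_supIrred hq
  obtain ⟨r', hr'⟩ := exists_isGreatest_lt_of_supIrred hr
  have pp := SupIrred.supPrime hp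
  have pq := SupIrred.supPrime hq
  have pr := SupIrred.supPrime hr
  -- Above this `u`, joining any of `p`, `q`, `r` not yet below an element is a cover; by primality
  -- none of the three is below `u`.
  let u : D := p' ⊔ q' ⊔ r'
  have cp : ∀ x, u ≤ x → ¬ p ≤ x → x ⋖ x ⊔ p := fun x hx =>
    covBy_sup_of_isGreatest_lt hp' ((le_sup_left.trans le_sup_left).trans hx)
  have cq : ∀ x, u ≤ x → ¬ q ≤ x → x ⋖ x ⊔ q := fun x hx =>
    covBy_sup_of_isGreatest_lt hq' ((le_sup_right.trans le_sup_left).trans hx)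
  have cr : ∀ x, u ≤ x → ¬ r ≤ x → x ⋖ x ⊔ r := fun x hx =>
    covBy_sup_of_isGreatest_lt hr' (le_sup_right.trans hx)
  have lp : p' ≤ p := hp'.1.le
  have lq : q' ≤ q := hq'.1.le
  have lr : r' ≤ r := hr'.1.le
  have hpu : ¬ p ≤ u := fun h => by
    rcases pp.le_sup.1 h with h | h
    · exact (pp.le_sup.1 h).elim hp'.1.not_ge fun h => hpq (h.trans lq)
    · exact hpr (h.trans lr)
  have hqu : ¬ q ≤ u := fun h => by
    rcases pq.le_sup.1 h with h | h
    · exact (pq.le_sup.1 h).elim (fun h => hqp (h.trans lp)) hq'.1.not_ge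
    · exact hqr (h.trans lr)
  have hru : ¬ r ≤ u := fun h => by
    rcases pr.le_sup.1 h with h | h
    · exact (pr.le_sup.1 h).elim (fun h => hrp (h.trans lp)) fun h => hrq (h.trans lq)
    · exact hr'.1.not_ge h
  have up := cp u le_rfl hpu
  have uq := cq u le_rfl hqu
  have ur := cr u le_rfl hru
  obtain ⟨m, hm, hmp, hmq, hmr⟩ : ∃ m, (pos u).2 < m ∧ m ≤ (pos (u ⊔ p)).2 ∧
      m ≤ (pos (u ⊔ q)).2 ∧ m ≤ (pos (u ⊔ r)).2 :=
    ⟨min (pos (u ⊔ p)).2 (min (pos (u ⊔ q)).2 (pos (u ⊔ r)).2),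
      lt_min (hpos.upward _ _ up.lt) (lt_min (hpos.upward _ _ uq.lt) (hpos.upward _ _ ur.lt)),
      min_le_left _ _, (min_le_right _ _).trans (min_le_left _ _),
      (min_le_right _ _).trans (min_le_right _ _)⟩
  have npq : u ⊔ p ≠ u ⊔ q := fun h => (pp.le_sup.1 (le_sup_right.trans h.le)).elim hpu hpq
  have npr : u ⊔ p ≠ u ⊔ r := fun h => (pp.le_sup.1 (le_sup_right.trans h.le)).elim hpu hpr
  have nqr : u ⊔ q ≠ u ⊔ r := fun h => (pq.le_sup.1 (le_sup_right.trans h.le)).elim hqu hqr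
  -- Six sign patterns are the left-to-right orders of the three edges at height `m`; the other two
  -- are cyclic.
  rcases (hpos.lineAt_ne up uq npq hm hmp hmq).lt_or_gt with h₁ | h₁ <;>
  rcases (hpos.lineAt_ne up ur npr hm hmp hmr).lt_or_gt with h₂ | h₂ <;>
  rcases (hpos.lineAt_ne uq ur nqr hm hmq hmr).lt_or_gt with h₃ | h₃
  · exact hpos.false_of_cube pp pq pr hpq hpr hqp hqr hrp hrq hpu hqu hru cp cq cr hm hmp hmq hmr
      h₁ h₃
  · exact hpos.false_of_cube pp pr pq hpr hpq hrp hrq hqp hqr hpu hru hqu cp cr cq hm hmp hmr hmq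
      h₂ h₃
  · exact lt_asymm (h₁.trans h₃) h₂
  · exact hpos.false_of_cube pr pp pq hrp hrq hpr hpq hqr hqp hru hpu hqu cr cp cq hm hmr hmp hmq
      h₂ h₁
  · exact hpos.false_of_cube pq pp pr hqp hqr hpq hpr hrq hrp hqu hpu hru cq cp cr hm hmq hmp hmr
      h₁ h₂
  · exact lt_asymm (h₂.trans h₃) h₁
  · exact hpos.false_of_cube pq pr pp hqr hqp hrq hrp hpq hpr hqu hru hpu cq cr cp hm hmq hmr hmp
      h₃ h₂
  · exact hpos.false_of_cube pr pq pp hrq hrp hqr hqp hpr hpq hru hqu hpu cr cq cp hm hmr hmq hmp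
      h₃ h₁

end Cube

/-! ### Join-irreducible elements of width at most two give a planar diagram -/

section Grid

variable {D : Type u} [DistribLattice D] [BoundedOrder D] [Finite D]

/-- The number of join-irreducible elements of `C` below `x`. -/
noncomputable def rank {D : Type u} [Lattice D] (C : Set D) (x : D) : ℕ :=
  {p | SupIrred p ∧ p ∈ C ∧ p ≤ x}.ncard

theorem rank_mono {D : Type u} [Lattice D] [Finite D] (C : Set D) : Monotone (rank C) :=
  fun _ _ h => Set.ncard_le_ncard (fun _ hp => ⟨hp.1, hp.2.1, hp.2.2.trans h⟩) (Set.toFinite _)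

/-- The irreducibles of `C` below an element form an initial segment of a chain, so their number
determines them. -/
theorem SplitsIntoChains.le_of_rank_le {D : Type u} [Lattice D] [Finite D] {C : Set D}
    (hC : SplitsIntoChains (J D) C) {x y p : D} (h : rank C x ≤ rank C y) (hp : SupIrred p)
    (hpC : p ∈ C) (hpx : p ≤ x) : p ≤ y := by
  by_contra hpy
  refine h.not_gt (Set.ncard_lt_ncard ⟨fun q hq => ⟨hq.1, hq.2.1, ?_⟩, fun hsub =>
    hpy (hsub (a := p) ⟨hp, hpC, hpx⟩).2.2⟩ (Set.toFinite _))
  rcases hC p hp q hq.1 (by simp [hpC, hq.2.1]) with hpq | hqp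
  · exact absurd (hpq.trans hq.2.2) hpy
  · exact hqp.trans hpx

theorem SplitsIntoChains.le_of_rank_le_of_rank_le {C : Set D} (hC : SplitsIntoChains (J D) C)
    {x y : D} (h₁ : rank C x ≤ rank C y) (h₂ : rank Cᶜ x ≤ rank Cᶜ y) : x ≤ y := by
  refine le_of_forall_supIrred_le fun p hp hpx => ?_
  by_cases hpC : p ∈ C
  · exact hC.le_of_rank_le h₁ hp hpC hpx
  · exact hC.compl.le_of_rank_le h₂ hp hpC hpx

/-- If `p` and `q` are both new below `y`, then `x ⊔ p = x ⊔ q = y`, and primality gives `p ≤ q` and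
`q ≤ p`. -/
theorem exists_unique_supIrred_of_covBy {x y : D} (h : x ⋖ y) :
    ∃ p, SupIrred p ∧ ¬ p ≤ x ∧ ∀ q, SupIrred q → (q ≤ y ↔ q = p ∨ q ≤ x) := by
  have sup_eq : ∀ p, p ≤ y → ¬ p ≤ x → x ⊔ p = y := fun p hpy hpx =>
    (h.eq_or_eq le_sup_left (sup_le h.le hpy)).resolve_left fun h => hpx (h ▸ le_sup_right)
  obtain ⟨p, hp, hpy, hpx⟩ := exists_supIrred_le_not_le h.lt.not_ge
  refine ⟨p, hp, hpx, fun q hq => ⟨fun hqy => ?_, ?_⟩⟩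
  · by_contra! hne
    have hqp := ((SupIrred.supPrime hq).le_sup.1 (hqy.trans (sup_eq p hpy hpx).ge)).resolve_left
      hne.2
    have hpq := ((SupIrred.supPrime hp).le_sup.1 (hpy.trans (sup_eq q hqy hne.2).ge)).resolve_left
      hpx
    exact hne.1 (le_antisymm hqp hpq)
  · rintro (rfl | hqx)
    exacts [hpy, hqx.trans h.le]

theorem rank_of_covBy (C : Set D) {x y : D} (h : x ⋖ y) :
    (rank C y = rank C x + 1 ∧ rank Cᶜ y = rank Cᶜ x) ∨
      (rank Cᶜ y = rank Cᶜ x + 1 ∧ rank C y = rank C x) := by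
  obtain ⟨p, hp, hpx, hpy⟩ := exists_unique_supIrred_of_covBy h
  have mem : ∀ C : Set D, p ∈ C → rank C y = rank C x + 1 := fun C hpC => by
    rw [rank, rank, ← Set.ncard_insert_of_notMem (fun hmem => hpx hmem.2.2) (Set.toFinite _)]
    congr 1
    ext q
    constructor
    · rintro ⟨hq, hqC, hqy⟩
      exact ((hpy q hq).1 hqy).imp_right fun hqx => ⟨hq, hqC, hqx⟩
    · rintro (rfl | ⟨hq, hqC, hqx⟩)
      exacts [⟨hp, hpC, (hpy q hp).2 (Or.inl rfl)⟩, ⟨hq, hqC, hqx.trans h.le⟩]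
  have notMem : ∀ C : Set D, p ∉ C → rank C y = rank C x := fun C hpC => by
    rw [rank, rank]
    congr 1
    ext q
    constructor
    · rintro ⟨hq, hqC, hqy⟩
      exact ⟨hq, hqC, ((hpy q hq).1 hqy).resolve_left fun h => hpC (h ▸ hqC)⟩
    · rintro ⟨hq, hqC, hqx⟩
      exact ⟨hq, hqC, hqx.trans h.le⟩
  by_cases hpC : p ∈ C
  · exact Or.inl ⟨mem C hpC, notMem _ (not_not.2 hpC)⟩
  · exact Or.inr ⟨mem _ hpC, notMem C hpC⟩

/-- The point with coordinates `s` and `t` in the square grid that stands on one of its corners. -/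
def gridPoint (s t : ℝ) : ℝ × ℝ := (s - t, s + t)

theorem gridPoint_inj {s t s' t' : ℝ} : gridPoint s t = gridPoint s' t' ↔ s = s' ∧ t = t' := by
  simp only [gridPoint, Prod.mk.injEq]
  exact ⟨fun ⟨h₁, h₂⟩ => ⟨by linarith, by linarith⟩, fun ⟨h₁, h₂⟩ => ⟨by linarith, by linarith⟩⟩

theorem exists_gridPoint_of_mem_segment {i j i' j' : ℝ} {z : ℝ × ℝ}
    (hz : z ∈ segment ℝ (gridPoint i j) (gridPoint i' j')) :
    ∃ θ, 0 ≤ θ ∧ θ ≤ 1 ∧ z = gridPoint (i + θ * (i' - i)) (j + θ * (j' - j)) := by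
  rw [segment_eq_image'] at hz
  obtain ⟨θ, hθ, rfl⟩ := hz
  refine ⟨θ, hθ.1, hθ.2, ?_⟩
  ext <;> simp [gridPoint] <;> ring

/-- The diagram given by a splitting of the join-irreducible elements into two chains. -/
noncomputable def gridDiagram (C : Set D) (x : D) : ℝ × ℝ := gridPoint (rank C x) (rank Cᶜ x)

theorem exists_of_mem_edge (C : Set D) {a b : D} (hab : a ⋖ b) {z : ℝ × ℝ}
    (hz : z ∈ segment ℝ (gridDiagram C a) (gridDiagram C b)) :
    ∃ s t, z = gridPoint s t ∧
      ((rank C b = rank C a + 1 ∧ rank Cᶜ b = rank Cᶜ a ∧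
          t = rank Cᶜ a ∧ rank C a ≤ s ∧ s ≤ rank C a + 1) ∨
        (rank Cᶜ b = rank Cᶜ a + 1 ∧ rank C b = rank C a ∧
          s = rank C a ∧ rank Cᶜ a ≤ t ∧ t ≤ rank Cᶜ a + 1)) := by
  obtain ⟨θ, h₀, h₁, rfl⟩ := exists_gridPoint_of_mem_segment hz
  refine ⟨_, _, rfl, ?_⟩
  rcases rank_of_covBy C hab with ⟨h, h'⟩ | ⟨h, h'⟩
  · refine Or.inl ⟨h, h', ?_, ?_, ?_⟩
    all_goals simp only [h, h', sub_self, mul_zero, add_zero]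
    all_goals first | done | (push_cast; linarith)
  · refine Or.inr ⟨h, h', ?_, ?_, ?_⟩
    all_goals simp only [h, h', sub_self, mul_zero, add_zero]
    all_goals first | done | (push_cast; linarith)

theorem eq_or_eq_of_le_of_le_add_one {i k : ℕ} (h₁ : (k : ℝ) ≤ i) (h₂ : (i : ℝ) ≤ k + 1) :
    i = k ∨ i = k + 1 := by
  have h₁ : k ≤ i := by exact_mod_cast h₁
  have h₂ : i ≤ k + 1 := by exact_mod_cast h₂
  omega

theorem eq_or_eq_of_gridPoint_mem_edge (C : Set D) {a b : D} (hab : a ⋖ b) {i j : ℕ}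
    (hz : gridPoint i j ∈ segment ℝ (gridDiagram C a) (gridDiagram C b)) :
    gridPoint i j = gridDiagram C a ∨ gridPoint i j = gridDiagram C b := by
  obtain ⟨s, t, hst, h⟩ := exists_of_mem_edge C hab hz
  obtain ⟨rfl, rfl⟩ := gridPoint_inj.1 hst
  simp only [gridDiagram, gridPoint_inj, Nat.cast_inj]
  rcases h with ⟨h, h', ht, h₁, h₂⟩ | ⟨h, h', hs, h₁, h₂⟩
  · have := eq_or_eq_of_le_of_le_add_one h₁ h₂
    rw [Nat.cast_inj] at ht
    omega
  · have := eq_or_eq_of_le_of_le_add_one h₁ h₂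
    rw [Nat.cast_inj] at hs
    omega

theorem natCast_of_mem_two_intervals {i k : ℕ} (hik : i ≠ k) {s : ℝ} (h₁ : i ≤ s) (h₂ : s ≤ i + 1)
    (h₃ : k ≤ s) (h₄ : s ≤ k + 1) : ∃ n : ℕ, s = n := by
  rcases hik.lt_or_gt with h | h
  · have : (i : ℝ) + 1 ≤ k := by exact_mod_cast h
    exact ⟨k, by linarith⟩
  · have : (k : ℝ) + 1 ≤ i := by exact_mod_cast h
    exact ⟨i, by linarith⟩

theorem SplitsIntoChains.isPlanarDiagram {C : Set D} (hC : SplitsIntoChains (J D) C) :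
    IsPlanarDiagram (gridDiagram C) := by
  have eq_of_rank : ∀ {x y : D}, rank C x = rank C y → rank Cᶜ x = rank Cᶜ y → x = y :=
    fun h₁ h₂ => le_antisymm (hC.le_of_rank_le_of_rank_le h₁.le h₂.le)
      (hC.le_of_rank_le_of_rank_le h₁.ge h₂.ge)
  have inj : Function.Injective (gridDiagram C) := fun x y hxy => by
    simp only [gridDiagram, gridPoint_inj, Nat.cast_inj] at hxy
    exact eq_of_rank hxy.1 hxy.2
  refine ⟨inj, fun a b hab => ?_, fun a b c hab hc => ?_, ?_⟩
  · have h₁ := rank_mono C hab.le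
    have h₂ := rank_mono Cᶜ hab.le
    have h₃ : ¬ (rank C b ≤ rank C a ∧ rank Cᶜ b ≤ rank Cᶜ a) := fun h =>
      hab.not_ge (hC.le_of_rank_le_of_rank_le h.1 h.2)
    have : rank C a + rank Cᶜ a < rank C b + rank Cᶜ b := by omega
    simp only [gridDiagram, gridPoint]
    exact_mod_cast this
  · exact (eq_or_eq_of_gridPoint_mem_edge C hab hc).imp (fun h => inj h) fun h => inj h
  · rintro a b c d hab hcd hne z ⟨h₁, h₂⟩
    -- A unit edge contains no grid points except its ends. Perpendicular edges meet in a grid point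
    -- because each fixes one integer coordinate; parallel ones because distinct unit intervals
    -- share only integers.
    suffices h : ∃ i j : ℕ, z = gridPoint i j by
      obtain ⟨i, j, rfl⟩ := h
      exact ⟨eq_or_eq_of_gridPoint_mem_edge C hab h₁, eq_or_eq_of_gridPoint_mem_edge C hcd h₂⟩
    obtain ⟨s, t, rfl, h⟩ := exists_of_mem_edge C hab h₁
    obtain ⟨s', t', hst, h'⟩ := exists_of_mem_edge C hcd h₂
    obtain ⟨rfl, rfl⟩ := gridPoint_inj.1 hst
    rcases h with ⟨hb, hb', ht, hs₁, hs₂⟩ | ⟨hb, hb', hs, ht₁, ht₂⟩ <;>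
    rcases h' with ⟨hd, hd', ht', hs₁', hs₂'⟩ | ⟨hd, hd', hs', ht₁', ht₂'⟩
    · have htt : rank Cᶜ a = rank Cᶜ c := by exact_mod_cast ht.symm.trans ht'
      have hik : rank C a ≠ rank C c := fun h => hne (Prod.ext (eq_of_rank h htt)
        (eq_of_rank (by dsimp only; omega) (by dsimp only; omega)))
      obtain ⟨n, rfl⟩ := natCast_of_mem_two_intervals hik hs₁ hs₂ hs₁' hs₂'
      exact ⟨n, _, by rw [ht]⟩
    · exact ⟨rank C c, rank Cᶜ a, by rw [ht, hs']⟩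
    · exact ⟨rank C a, rank Cᶜ c, by rw [ht', hs]⟩
    · have hss : rank C a = rank C c := by exact_mod_cast hs.symm.trans hs'
      have hik : rank Cᶜ a ≠ rank Cᶜ c := fun h => hne (Prod.ext (eq_of_rank hss h)
        (eq_of_rank (by dsimp only; omega) (by dsimp only; omega)))
      obtain ⟨n, rfl⟩ := natCast_of_mem_two_intervals hik ht₁ ht₂ ht₁' ht₂'
      exact ⟨_, n, by rw [hs]⟩

theorem WidthLETwo.isPlanar (h : WidthLETwo (J D)) : IsPlanar D := by
  obtain ⟨C, hC⟩ := h.exists_splitsIntoChains (Set.toFinite _)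
  exact ⟨inferInstance, _, hC.isPlanarDiagram⟩

end Grid

/-! ### Necessary conditions -/

section Necessary

variable {L : FirstOrder.Language.{v, 0}} {A : Type w} [L.Structure A]

/-- It suffices to change one argument of an operation at a time. -/
theorem isCongruence_of_update {r : Setoid A}
    (h : ∀ (n : ℕ) (f : L.Functions n) (z : Fin n → A) (i : Fin n) (a b : A), r a b →
      r (FirstOrder.Language.Structure.funMap f (Function.update z i a))
        (FirstOrder.Language.Structure.funMap f (Function.update z i b))) :
    IsCongruence L r := by
  intro n f x y hxy
  have key : ∀ s : Finset (Fin n), r (FirstOrder.Language.Structure.funMap f x)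
      (FirstOrder.Language.Structure.funMap f (s.piecewise y x)) := by
    intro s
    induction s using Finset.induction_on with
    | empty => simp
    | insert i s his ih =>
      refine r.trans ih ?_
      have := h n f (s.piecewise y x) i (x i) (y i) (hxy i)
      rwa [← Finset.piecewise_insert, Function.update_eq_self_iff.mpr (by simp [his])] at this
  simpa using key Finset.univ

theorem Congruence.rel_update (θ : Congruence L A) {n : ℕ} (f : L.Functions n) (z : Fin n → A)
    (i : Fin n) {a b : A} (hab : θ.1 a b) :
    θ.1 (FirstOrder.Language.Structure.funMap f (Function.update z i a))
      (FirstOrder.Language.Structure.funMap f (Function.update z i b)) := by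
  refine θ.2 n f _ _ fun j => ?_
  by_cases hj : j = i
  · subst hj
    simpa using hab
  · simp [hj]

theorem con_le_iff {a b : A} {θ : Congruence L A} : con L a b ≤ θ ↔ θ.1 a b :=
  ⟨fun h => h (con_isLeast L a b).1, fun h => (con_isLeast L a b).2 h⟩

/-- An equivalence relation on `A` is not the union of two proper equivalence subrelations. -/
theorem forall_or_forall_of_forall_or {A : Type w} (r s : Setoid A)
    (h : ∀ a b, r a b ∨ s a b) : (∀ a b, r a b) ∨ ∀ a b, s a b := by
  by_contra! hcon
  obtain ⟨⟨a, b, hab⟩, c, d, hcd⟩ := hcon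
  have sab := (h a b).resolve_left hab
  have rcd := (h c d).resolve_right hcd
  rcases h a c with hac | hac
  · have sbc := (h b c).resolve_left fun hbc => hab (r.trans hac (r.symm hbc))
    have sad := (h b d).resolve_left fun hbd =>
      hab (r.trans (r.trans hac rcd) (r.symm hbd))
    exact hcd (s.trans (s.symm sbc) sad)
  · have rad := (h a d).resolve_right fun had => hcd (s.trans (s.symm hac) had)
    have rbd := (h b d).resolve_right fun hbd =>
      hcd (s.trans (s.trans (s.symm hac) sab) hbd)
    exact hab (r.trans rad (r.symm rbd))

variable {D : Type u} [DistribLattice D] [BoundedOrder D]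

/-- If `⊤ = x ⊔ y` with `x, y < ⊤`, primality puts every principal congruence below `x` or `y`, so
two proper equivalences cover all pairs. -/
theorem RepresentsInclusion.top_mem_J₀ (h : RepresentsInclusion L A (J₀ D)) : ⊤ ∈ J₀ D := by
  obtain ⟨φ, hφ⟩ := h
  by_contra hcon
  rcases not_supIrred.1 fun h => hcon (Or.inl h) with hmin | ⟨x, y, hxy, hx, hy⟩
  · exact hcon (Or.inr hmin.eq_bot)
  have top_of : ∀ z : D, (∀ a b, (φ.symm z).1 a b) → z = ⊤ := fun z hz => by
    exact top_le_iff.1 (φ.symm.le_iff_le.1 fun a b _ => hz a b)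
  have hrel : ∀ z a b, (φ.symm z).1 a b ↔ φ (con L a b) ≤ z := fun z a b => by
    rw [← con_le_iff, φ.le_symm_apply]
  have hor : ∀ a b, (φ.symm x).1 a b ∨ (φ.symm y).1 a b := fun a b => by
    rw [hrel, hrel]
    have hmem : φ (con L a b) ∈ J₀ D := hφ ▸ ⟨_, ⟨a, b, rfl⟩, rfl⟩
    rcases hmem with hJ | hbot
    · exact (SupIrred.supPrime hJ).le_sup.1 (hxy ▸ le_top)
    · exact Or.inl (hbot.le.trans bot_le)
  rcases forall_or_forall_of_forall_or _ _ hor with h | h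
  · exact hx.ne (top_of x h)
  · exact hy.ne (top_of y h)

theorem RepresentsInclusion.comparable {p q r : D} (hp : SupIrred p) (hq : SupIrred q)
    (hr : SupIrred r) (h : RepresentsInclusion L A (J₀ D ∪ {p ⊔ q ⊔ r})) :
    (p ≤ q ∨ q ≤ p) ∨ (p ≤ r ∨ r ≤ p) ∨ (q ≤ r ∨ r ≤ q) := by
  obtain ⟨φ, hφ⟩ := h
  by_contra hcon
  push Not at hcon
  obtain ⟨⟨hpq, hqp⟩, ⟨hpr, hrp⟩, hqr, hrq⟩ := hcon
  have pp := SupIrred.supPrime hp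
  have pq := SupIrred.supPrime hq
  have pr := SupIrred.supPrime hr
  let below : D → Prop := fun x => x ≤ p ∨ x ≤ q ∨ x ≤ r
  have below_of_mem : ∀ x ∈ J₀ D, x ≤ p ⊔ q ⊔ r → below x := by
    rintro x (hx | rfl) hxle
    · rcases (SupIrred.supPrime hx).le_sup.1 hxle with h | h
      · exact ((SupIrred.supPrime hx).le_sup.1 h).imp_right Or.inl
      · exact Or.inr (Or.inr h)
    · exact Or.inl bot_le
  have below_sup : ∀ {x y}, below x → below y → x ⊔ y ≤ p ⊔ q ⊔ r ∧ ¬ p ⊔ q ⊔ r ≤ x ⊔ y := by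
    intro x y hx hy
    have hle : ∀ {x}, below x → x ≤ p ⊔ q ⊔ r := by
      rintro x (h | h | h)
      exacts [h.trans (le_sup_left.trans le_sup_left), h.trans (le_sup_right.trans le_sup_left),
        h.trans le_sup_right]
    refine ⟨sup_le (hle hx) (hle hy), fun h => ?_⟩
    have h₁ := pp.le_sup.1 ((le_sup_left.trans le_sup_left).trans h)
    have h₂ := pq.le_sup.1 ((le_sup_right.trans le_sup_left).trans h)
    have h₃ := pr.le_sup.1 (le_sup_right.trans h)
    -- The bounds of `x` and `y` use at most two of `p`, `q`, `r`; primality of an unused one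
    -- contradicts incomparability.
    rcases hx with hx | hx | hx <;> rcases hy with hy | hy | hy <;>
    first
      | exact h₁.elim (fun h => hpq (h.trans hx)) (fun h => hpq (h.trans hy))
      | exact h₁.elim (fun h => hpq (h.trans hx)) (fun h => hpr (h.trans hy))
      | exact h₁.elim (fun h => hpr (h.trans hx)) (fun h => hpq (h.trans hy))
      | exact h₁.elim (fun h => hpr (h.trans hx)) (fun h => hpr (h.trans hy))
      | exact h₂.elim (fun h => hqp (h.trans hx)) (fun h => hqp (h.trans hy))
      | exact h₂.elim (fun h => hqp (h.trans hx)) (fun h => hqr (h.trans hy))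
      | exact h₂.elim (fun h => hqr (h.trans hx)) (fun h => hqp (h.trans hy))
      | exact h₃.elim (fun h => hrp (h.trans hx)) (fun h => hrp (h.trans hy))
      | exact h₃.elim (fun h => hrp (h.trans hx)) (fun h => hrq (h.trans hy))
      | exact h₃.elim (fun h => hrq (h.trans hx)) (fun h => hrp (h.trans hy))
  have hrel : ∀ z a b, (φ.symm z).1 a b ↔ φ (con L a b) ≤ z := fun z a b => by
    rw [← con_le_iff, φ.le_symm_apply]
  have below_iff : ∀ a b, below (φ (con L a b)) ↔
      (φ.symm p).1 a b ∨ (φ.symm q).1 a b ∨ (φ.symm r).1 a b := fun a b => by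
    simp only [hrel, below]
  -- the union of the three congruences is a congruence
  let S : Setoid A := ⟨fun a b => below (φ (con L a b)), fun a => by
      rw [below_iff]; exact Or.inl ((φ.symm p).1.refl a), fun {a b} hab => by
      rw [below_iff] at hab ⊢
      exact hab.imp (φ.symm p).1.symm (Or.imp (φ.symm q).1.symm (φ.symm r).1.symm),
      fun {a b c} hab hbc => by
      obtain ⟨h₁, h₂⟩ := below_sup hab hbc
      have hle : φ (con L a c) ≤ φ (con L a b) ⊔ φ (con L b c) := by
        -- Transitivity is the point where `Q` matters: `con L a c` is below a join that does not
        -- reach `p ⊔ q ⊔ r`, so it lies in `J₀ D` and primality applies.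
        rw [← hrel]
        exact (φ.symm _).1.trans ((hrel _ _ _).2 le_sup_left) ((hrel _ _ _).2 le_sup_right)
      have hmem : φ (con L a c) ∈ J₀ D ∪ {p ⊔ q ⊔ r} := hφ ▸ ⟨_, ⟨a, c, rfl⟩, rfl⟩
      rcases hmem with hmem | hmem
      · exact below_of_mem _ hmem (hle.trans h₁)
      · exact absurd ((Set.mem_singleton_iff.1 hmem).ge.trans hle) h₂⟩
  -- Changing one argument stays within a single one of the three congruences.
  have hS : IsCongruence L S := isCongruence_of_update fun n f z i a b hab => by
    refine (below_iff _ _).2 (((below_iff _ _).1 hab).imp ?_ (Or.imp ?_ ?_)) <;>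
    exact Congruence.rel_update _ f z i
  obtain ⟨Θ, hΘ⟩ : ∃ Θ : Congruence L A, ∀ a b, Θ.1 a b ↔ below (φ (con L a b)) :=
    ⟨⟨S, hS⟩, fun _ _ => Iff.rfl⟩
  have hle : ∀ z, (∀ a b, (φ.symm z).1 a b → below (φ (con L a b))) → z ≤ φ Θ := fun z hz => by
    rw [← φ.symm_apply_le]
    exact fun a b hab => (hΘ a b).2 (hz a b hab)
  have hT : p ⊔ q ⊔ r ≤ φ Θ := sup_le (sup_le
    (hle p fun a b h => (below_iff a b).2 (Or.inl h))
    (hle q fun a b h => (below_iff a b).2 (Or.inr (Or.inl h))))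
    (hle r fun a b h => (below_iff a b).2 (Or.inr (Or.inr h)))
  have hT' : p ⊔ q ⊔ r ∈ φ '' Princ L A := hφ ▸ Or.inr rfl
  obtain ⟨_, ⟨a, b, rfl⟩, hab⟩ := hT'
  have : below (φ (con L a b)) := by
    rwa [← hab, φ.le_iff_le, con_le_iff, hΘ] at hT
  obtain ⟨-, hnot⟩ := below_sup this this
  rw [hab] at hnot
  exact hnot le_sup_left

theorem FullyRepresentable.top_mem_J₀ (h : FullyRepresentable.{u, v, w} D) : ⊤ ∈ J₀ D := by
  obtain ⟨L, _, A, _, _, hA⟩ := h (J₀ D) subset_rfl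
  exact hA.top_mem_J₀

theorem FullyRepresentable.widthLETwo_J (h : FullyRepresentable.{u, v, w} D) :
    WidthLETwo (J D) := by
  intro p hp q hq r hr
  obtain ⟨L, _, A, _, _, hA⟩ := h (J₀ D ∪ {p ⊔ q ⊔ r}) Set.subset_union_left
  exact hA.comparable hp hq hr

end Necessary

/-! ### Join-irreducibility of the greatest element -/

theorem top_mem_J₀_iff (D : Type u) [Lattice D] [BoundedOrder D] [Finite D] :
    ⊤ ∈ J₀ D ↔ Nat.card D = 1 ∨ ∃! c : D, IsCoatom c := by
  constructor
  · rintro (h | h)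
    · have : Nontrivial D := ⟨⊤, ⊥, SupIrred.ne_bot h⟩
      obtain ⟨c, hc⟩ := IsCoatomic.exists_coatom D
      refine Or.inr ⟨c, hc, fun c' hc' => ?_⟩
      by_contra hne
      rcases h.2 (hc'.sup_eq_top_of_ne hc hne) with h | h
      exacts [hc'.1 h, hc.1 h]
    · left
      have := subsingleton_of_bot_eq_top (Set.mem_singleton_iff.1 h).symm
      exact Nat.card_unique
  · rintro (h | ⟨c, hc, huniq⟩)
    · have := (Nat.card_eq_one_iff_unique.1 h).1
      exact Or.inr (Subsingleton.elim _ _)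
    · refine Or.inl ⟨fun h => hc.1 (h.eq_bot.symm ▸ ?_), fun x y hxy => ?_⟩
      · exact (eq_bot_iff.2 (h.eq_bot ▸ le_top : c ≤ ⊥))
      · by_contra! hne
        obtain ⟨c₁, hc₁, h₁⟩ := (eq_top_or_exists_le_coatom x).resolve_left hne.1
        obtain ⟨c₂, hc₂, h₂⟩ := (eq_top_or_exists_le_coatom y).resolve_left hne.2
        rw [huniq c₁ hc₁] at h₁
        rw [huniq c₂ hc₂] at h₂
        exact hc.1 (top_le_iff.1 (hxy ▸ sup_le h₁ h₂))

/-! ### Algebras of contractions of lattice-valued ultrametric spaces -/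

/-- A `D`-valued ultrametric in which any two points `a`, `b` are joined by a path whose steps
have join-irreducible lengths below `d a b`. -/
structure IsChainedUltrametric {D : Type u} [Lattice D] [BoundedOrder D] {A : Type w}
    (d : A → A → D) : Prop where
  eq_bot_iff : ∀ a b, d a b = ⊥ ↔ a = b
  symm : ∀ a b, d a b = d b a
  triangle : ∀ a b c, d a c ≤ d a b ⊔ d b c
  chained : ∀ a b, Relation.ReflTransGen (fun x y => SupIrred (d x y) ∧ d x y ≤ d a b) a b

section Contractions

variable {D : Type u} [DistribLattice D] [BoundedOrder D] {A : Type w}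

/-- The `n`-ary operations that do not increase distances. -/
def Contraction (d : A → A → D) (n : ℕ) : Type w :=
  {f : (Fin n → A) → A // ∀ x y z, (∀ i, d (x i) (y i) ≤ z) → d (f x) (f y) ≤ z}

/-- Finiteness makes the set of operations small, so `Shrink` can move it to any universe. -/
instance [Finite A] (d : A → A → D) (n : ℕ) : Finite (Contraction d n) :=
  inferInstanceAs (Finite (Subtype _))

variable [Finite A]

/-- The similarity type with a symbol for every contraction. -/
def contractionLanguage (d : A → A → D) : FirstOrder.Language.{v, 0} where
  Functions n := Shrink.{v} (Contraction d n)
  Relations _ := PEmpty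

noncomputable instance contractionStructure (d : A → A → D) :
    (contractionLanguage.{u, v, w} d).Structure A where
  funMap f := ((equivShrink.{v} (Contraction d _)).symm f).1
  RelMap r := r.elim

variable {d : A → A → D}

/-- The congruence of all pairs at distance at most `z`. -/
def ballCongruence (hd : IsChainedUltrametric d) (z : D) : Congruence (contractionLanguage.{u, v, w} d) A :=
  ⟨⟨fun a b => d a b ≤ z, fun a => ((hd.eq_bot_iff a a).2 rfl).le.trans bot_le,
    fun {a b} h => (hd.symm b a).le.trans h,
    fun {a b c} h₁ h₂ => (hd.triangle a b c).trans (sup_le h₁ h₂)⟩,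
    fun _ f x y h => ((equivShrink.{v} (Contraction d _)).symm f).2 x y z h⟩

/-- If `d c e` is join-irreducible and at most `d a b`, then a contraction maps `a` to `c` and
`b` to `e`. -/
theorem rel_of_supIrred_of_le (θ : Congruence (contractionLanguage.{u, v, w} d) A) {a b c e : A}
    (hd : IsChainedUltrametric d) (hab : θ.1 a b) (hce : SupIrred (d c e))
    (hle : d c e ≤ d a b) : θ.1 c e := by
  classical
  have hprime := SupIrred.supPrime hce
  -- If `f` separates `x` from `y`, then `d c e` is below exactly one of `d a x`, `d a y`; the
  -- triangle inequality and primality force `d c e ≤ d x y`.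
  let f : A → A := fun x => if d c e ≤ d a x then e else c
  have hf : ∀ x y z, d x y ≤ z → d (f x) (f y) ≤ z := by
    intro x y z hz
    by_cases hx : d c e ≤ d a x <;> by_cases hy : d c e ≤ d a y
    · simp only [f, if_pos hx, if_pos hy, (hd.eq_bot_iff e e).2 rfl, bot_le]
    · simp only [f, if_pos hx, if_neg hy]
      rw [hd.symm e c]
      refine le_trans ?_ hz
      rw [hd.symm x y]
      exact (hprime.le_sup.1 (hx.trans (hd.triangle a y x))).resolve_left hy
    · simp only [f, if_neg hx, if_pos hy]
      exact ((hprime.le_sup.1 (hy.trans (hd.triangle a x y))).resolve_left hx).trans hz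
    · simp only [f, if_neg hx, if_neg hy, (hd.eq_bot_iff c c).2 rfl, bot_le]
  let F : Contraction d 1 := ⟨fun x => f (x 0), fun x y z h => hf _ _ z (h 0)⟩
  have := θ.2 1 (equivShrink.{v} (Contraction d 1) F) (fun _ => a) (fun _ => b) fun _ => hab
  have hFa : f a = c := if_neg fun h => hce.ne_bot
    (le_bot_iff.1 (h.trans ((hd.eq_bot_iff a a).2 rfl).le))
  have hFb : f b = e := if_pos hle
  have hmap : ∀ x : Fin 1 → A, FirstOrder.Language.Structure.funMap
      (L := contractionLanguage.{u, v, w} d) (equivShrink.{v} (Contraction d 1) F) x = f (x 0) :=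
    fun x => congrArg (fun G : Contraction d 1 => G.1 x)
      (Equiv.symm_apply_apply (equivShrink.{v} (Contraction d 1)) F)
  rw [hmap, hmap, hFa, hFb] at this
  exact this

theorem ballCongruence_le_iff [Finite D] (hd : IsChainedUltrametric d)
    (hJ : ∀ p, SupIrred p → ∃ a b, d a b = p) {y z : D} :
    ballCongruence.{u, v, w} hd y ≤ ballCongruence hd z ↔ y ≤ z := by
  refine ⟨fun h => le_of_forall_supIrred_le fun p hp hpy => ?_,
    fun h a b hab => le_trans (α := D) hab h⟩
  obtain ⟨a, b, rfl⟩ := hJ p hp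
  exact h hpy

/-- The radius is the join of all distances within `θ`. An irreducible step below it is, by
primality, below a single such distance, so a contraction puts it in `θ`; chains of steps give the
remaining pairs. -/
theorem ballCongruence_surjective (hd : IsChainedUltrametric d) :
    Function.Surjective (ballCongruence.{u, v, w} hd) := by
  classical
  intro θ
  cases nonempty_fintype A
  let s : Finset (A × A) := Finset.univ.filter fun x => θ.1 x.1 x.2
  refine ⟨s.sup fun x => d x.1 x.2, le_antisymm (fun a b hab => ?_) fun a b hab =>
    Finset.le_sup (f := fun x : A × A => d x.1 x.2)
      (by simpa [s] using hab : ((a, b) : A × A) ∈ s)⟩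
  have step : ∀ x y, SupIrred (d x y) → d x y ≤ d a b → θ.1 x y := fun x y hxy hle => by
    obtain ⟨⟨a', b'⟩, hmem, hle'⟩ := (SupIrred.supPrime hxy).le_finset_sup.1 (hle.trans hab)
    exact rel_of_supIrred_of_le θ hd (by simpa [s] using hmem) hxy hle'
  have := hd.chained a b
  -- Only the endpoint of the chain varies in the induction; the bound `d a b` stays fixed.
  generalize hb : b = b' at this
  replace this : Relation.ReflTransGen (fun x y => SupIrred (d x y) ∧ d x y ≤ d a b) a b' := by
    simpa [hb] using this
  clear hb
  induction this with
  | refl => exact θ.1.refl a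
  | tail _ h ih => exact θ.1.trans ih (step _ _ h.1 h.2)

theorem IsChainedUltrametric.representsInclusion [Finite D] (hd : IsChainedUltrametric d)
    (hJ : J₀ D ⊆ {x | ∃ a b, d a b = x}) :
    RepresentsInclusion (contractionLanguage.{u, v, w} d) A {x | ∃ a b, d a b = x} := by
  have hle : ∀ {y z : D}, ballCongruence.{u, v, w} hd y ≤ ballCongruence hd z ↔ y ≤ z :=
    ballCongruence_le_iff hd fun p hp => hJ (Or.inl hp)
  let e : D ↪o Congruence (contractionLanguage.{u, v, w} d) A :=
    OrderEmbedding.ofMapLEIff (ballCongruence hd) fun _ _ => hle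
  let ψ : D ≃o Congruence (contractionLanguage.{u, v, w} d) A :=
    RelIso.ofSurjective e (ballCongruence_surjective hd)
  -- `con(a, b)` is itself a ball congruence, and its radius is at least `d a b`.
  have hψ : ∀ a b, ψ (d a b) = con _ a b := fun a b => by
    refine le_antisymm ?_ ((con_isLeast _ a b).2 (show d a b ≤ d a b from le_rfl))
    obtain ⟨z, hz⟩ := ballCongruence_surjective hd (con (contractionLanguage.{u, v, w} d) a b)
    have : (ballCongruence hd z).1 a b := hz ▸ (con_isLeast _ a b).1
    rw [← hz]
    exact hle.2 this
  refine ⟨ψ.symm, ?_⟩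
  ext x
  constructor
  · rintro ⟨_, ⟨a, b, rfl⟩, rfl⟩
    exact ⟨a, b, by rw [← hψ, ψ.symm_apply_apply]⟩
  · rintro ⟨a, b, rfl⟩
    exact ⟨_, ⟨a, b, rfl⟩, by rw [← hψ, ψ.symm_apply_apply]⟩

end Contractions

/-! ### Construction of the ultrametric space -/

section Construction

variable {D : Type u} [DistribLattice D] [BoundedOrder D]

/-- Take `p`, `q` maximal among the irreducibles below `x`, equal if `x` is irreducible. Any other
one is comparable with `p` or `q`, hence below it. -/
theorem WidthLETwo.exists_sup_eq [Finite D] (h : WidthLETwo (J D)) {x : D} (hx : x ≠ ⊥) :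
    ∃ p q, SupIrred p ∧ SupIrred q ∧ p ⊔ q = x := by
  obtain ⟨p₀, hp₀, hp₀x, -⟩ := exists_supIrred_le_not_le (fun hle => hx (le_bot_iff.1 hle) : ¬ x ≤ ⊥)
  obtain ⟨p, hpp, hp⟩ := (Set.toFinite {p | SupIrred p ∧ p ≤ x}).exists_le_maximal ⟨hp₀, hp₀x⟩
  by_cases hpx : x ≤ p
  · exact ⟨p, p, hp.prop.1, hp.prop.1, by rw [sup_idem]; exact le_antisymm hp.prop.2 hpx⟩
  obtain ⟨q₀, hq₀, hq₀x, hq₀p⟩ := exists_supIrred_le_not_le hpx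
  obtain ⟨q, hqq, hq⟩ := (Set.toFinite {p | SupIrred p ∧ p ≤ x}).exists_le_maximal ⟨hq₀, hq₀x⟩
  refine ⟨p, q, hp.prop.1, hq.prop.1, le_antisymm (sup_le hp.prop.2 hq.prop.2)
    (le_of_forall_supIrred_le fun r hr hrx => ?_)⟩
  rcases h p hp.prop.1 q hq.prop.1 r hr with (h | h) | (h | h) | (h | h)
  · exact absurd (hqq.trans (hp.le_of_ge hq.prop h)) hq₀p
  · exact absurd (hqq.trans h) hq₀p
  · exact (hp.le_of_ge ⟨hr, hrx⟩ h).trans le_sup_left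
  · exact h.trans le_sup_left
  · exact (hq.le_of_ge ⟨hr, hrx⟩ h).trans le_sup_right
  · exact h.trans le_sup_right

/-- The distance on three points `0`, `1`, `2` with distances `p` between `0` and `1`, `q` between
`1` and `2`, and `p ⊔ q` between `0` and `2`. -/
def triangleDist (p q : D) (i j : Fin 3) : D :=
  (if i = 0 ↔ j = 0 then ⊥ else p) ⊔ (if i = 2 ↔ j = 2 then ⊥ else q)

theorem isChainedUltrametric_triangleDist {p q : D} (hp : SupIrred p) (hq : SupIrred q) :
    IsChainedUltrametric (triangleDist p q) where
  eq_bot_iff i j := by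
    have := hp.ne_bot
    have := hq.ne_bot
    fin_cases i <;> fin_cases j <;> simp_all [triangleDist]
  symm i j := by simp [triangleDist, iff_comm]
  triangle i j k := by
    fin_cases i <;> fin_cases j <;> fin_cases k <;> simp [triangleDist]
  chained i j := by
    by_cases hij : i = j
    · subst hij
      exact .refl
    -- The distance `p ⊔ q` need not be irreducible, but the detour through the point `1` has steps
    -- `p` and `q`.
    by_cases h : i = 1 ∨ j = 1
    · refine .single ⟨?_, le_rfl⟩
      fin_cases i <;> fin_cases j <;> simp_all [triangleDist]
    · refine .head (b := 1) ?_ (.single ?_) <;>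
      fin_cases i <;> fin_cases j <;> simp_all [triangleDist]

/-- The disjoint union of the spaces `X i` and one further point, where points of different parts
have distance `⊤`. -/
noncomputable def sumDist {ι : Type u} {X : Type} (d : ι → X → X → D) :
    Option (ι × X) → Option (ι × X) → D
  | none, none => ⊥
  | some (i, x), some (j, y) => by classical exact if i = j then d i x y else ⊤
  | _, _ => ⊤

/-- An irreducible `⊤` lets different parts be joined by a single step. With no parts there is only
one point, so nothing is needed of `⊤`; this covers the one-element lattice. -/
theorem isChainedUltrametric_sumDist {ι : Type u} {X : Type} {d : ι → X → X → D}
    (hd : ∀ i, IsChainedUltrametric (d i)) (htop : Nonempty ι → SupIrred (⊤ : D)) :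
    IsChainedUltrametric (sumDist d) where
  eq_bot_iff a b := by
    rcases a with _ | ⟨i, x⟩ <;> rcases b with _ | ⟨j, y⟩
    · simp [sumDist]
    · simp [sumDist, (htop ⟨j⟩).ne_bot]
    · simp [sumDist, (htop ⟨i⟩).ne_bot]
    · by_cases hij : i = j
      · subst hij
        simp [sumDist, (hd i).eq_bot_iff]
      · simp [sumDist, hij, (htop ⟨i⟩).ne_bot]
  symm a b := by
    rcases a with _ | ⟨i, x⟩ <;> rcases b with _ | ⟨j, y⟩ <;> try rfl
    by_cases hij : i = j
    · subst hij
      simp [sumDist, (hd i).symm x y]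
    · simp [sumDist, hij, Ne.symm hij]
  triangle a b c := by
    rcases a with _ | ⟨i, x⟩ <;> rcases b with _ | ⟨j, y⟩ <;> rcases c with _ | ⟨k, z⟩ <;>
      try simp [sumDist]
    by_cases hij : i = j
    · subst hij
      by_cases hik : i = k
      · subst hik
        simpa using (hd i).triangle x y z
      · simp [hik]
    · simp [hij]
  chained a b := by
    rcases a with _ | ⟨i, x⟩ <;> rcases b with _ | ⟨j, y⟩
    · exact .refl
    · exact .single ⟨htop ⟨j⟩, le_rfl⟩
    · exact .single ⟨htop ⟨i⟩, le_rfl⟩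
    · by_cases hij : i = j
      · subst hij
        refine ((hd i).chained x y).lift (fun x => some (i, x)) fun x' y' h => ?_
        simpa [Function.onFun, sumDist] using h
      · refine .single ⟨?_, le_rfl⟩
        simpa [sumDist, hij] using htop ⟨i⟩

theorem IsChainedUltrametric.comap {A B : Type*} {d : A → A → D} (hd : IsChainedUltrametric d)
    (e : B ≃ A) : IsChainedUltrametric fun x y => d (e x) (e y) where
  eq_bot_iff x y := by rw [hd.eq_bot_iff, e.apply_eq_iff_eq]
  symm _ _ := hd.symm _ _
  triangle _ _ _ := hd.triangle _ _ _
  chained x y := by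
    simpa [Function.onFun] using (hd.chained (e x) (e y)).lift e.symm
      (p := fun x' y' => SupIrred (d (e x') (e y')) ∧ d (e x') (e y') ≤ d (e x) (e y))
      (fun a b h => by simpa [Function.onFun] using h)

theorem WidthLETwo.exists_isChainedUltrametric [Finite D] (h : WidthLETwo (J D))
    (htop : ⊤ ∈ J₀ D) {Q : Set D} (hQ : J₀ D ⊆ Q) :
    ∃ (A : Type u) (_ : Finite A) (_ : Nonempty A) (d : A → A → D),
      IsChainedUltrametric d ∧ {x | ∃ a b, d a b = x} = Q := by
  -- One triangle for each nonzero `x ∈ Q`; its distances `⊥`, `p x`, `q x`, `x` all lie in `Q`.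
  choose p q hp hq hpq using fun x : {x : D // x ∈ Q ∧ x ≠ ⊥} => h.exists_sup_eq x.2.2
  refine ⟨Option ({x : D // x ∈ Q ∧ x ≠ ⊥} × Fin 3), inferInstance, inferInstance,
    sumDist fun x => triangleDist (p x) (q x),
    isChainedUltrametric_sumDist (fun x => isChainedUltrametric_triangleDist (hp x) (hq x))
      fun ⟨x⟩ => htop.resolve_right fun h => x.2.2 (le_bot_iff.1 (le_top.trans h.le)),
    Set.Subset.antisymm ?_ fun x hx => ?_⟩
  · have hbot : ⊥ ∈ Q := hQ (Or.inr rfl)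
    have hirr : ∀ p, SupIrred p → p ∈ Q := fun p hp => hQ (Or.inl hp)
    rintro _ ⟨a, b, rfl⟩
    rcases a with _ | ⟨i, x⟩ <;> rcases b with _ | ⟨j, y⟩
    · exact hbot
    · exact hQ htop
    · exact hQ htop
    · by_cases hij : i = j
      · subst hij
        have := i.2.1
        fin_cases x <;> fin_cases y <;>
          simp [sumDist, triangleDist, hbot, hirr, hp, hq, hpq, this]
      · simpa [sumDist, hij] using hQ htop
  · by_cases hx0 : x = ⊥
    · exact ⟨none, none, hx0.symm⟩
    · refine ⟨some (⟨x, hx, hx0⟩, 0), some (⟨x, hx, hx0⟩, 2), ?_⟩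
      simp [sumDist, triangleDist, hpq]

theorem WidthLETwo.fullyRepresentable [Finite D] (h : WidthLETwo (J D)) (htop : ⊤ ∈ J₀ D) :
    FullyRepresentable.{u, v, w} D := by
  intro Q hQ
  obtain ⟨A, _, _, d, hd, rfl⟩ := h.exists_isChainedUltrametric htop hQ
  -- The space is finite, so it has a copy in universe `w`.
  let e : Shrink.{w} A ≃ A := (equivShrink.{w} A).symm
  have : Finite (Shrink.{w} A) := Finite.of_equiv A e.symm
  have hrange : {x | ∃ a b, d a b = x} = {x | ∃ a b, d (e a) (e b) = x} := by
    ext x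
    constructor
    · rintro ⟨a, b, hab⟩
      exact ⟨e.symm a, e.symm b, by simpa using hab⟩
    · rintro ⟨a, b, hab⟩
      exact ⟨_, _, hab⟩
  rw [hrange] at hQ ⊢
  exact ⟨contractionLanguage.{u, v, w} fun x y => d (e x) (e y),
    fun _ => inferInstanceAs (IsEmpty PEmpty), Shrink.{w} A, e.nonempty, inferInstance,
    (hd.comap e).representsInclusion hQ⟩

end Construction

end PrincRep
theorem proposition1p1 (D : Type u) [DistribLattice D] [BoundedOrder D] [Finite D] :
    (PrincRep.FullyRepresentable.{u, v, w} D ↔ PrincRep.IsPlanar D ∧ ⊤ ∈ PrincRep.J₀ D) ∧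
      (⊤ ∈ PrincRep.J₀ D ↔ Nat.card D = 1 ∨ ∃! c : D, IsCoatom c) := by
  refine ⟨⟨fun h => ⟨h.widthLETwo_J.isPlanar, h.top_mem_J₀⟩, ?_⟩, PrincRep.top_mem_J₀_iff D⟩
  rintro ⟨⟨-, pos, hpos⟩, htop⟩
  exact hpos.widthLETwo_J.fullyRepresentable htop
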